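/- Let $F$ be a field of characteristic different from two and let $q$ be an anisotropic quadratic form on a finite-dimensional nonzero vector space over $F$ (such a form is automatically non-degenerate). For a field extension $K/F$ let $q_K$ denote the form over $K$ obtained from $q$ by extension of scalars, let $D_K(q)\subseteq K^{\times}$ be the set of nonzero values of $q_K$, and let $G_K(q)=\{a\in K^{\times}\mid aq_K\simeq q_K\}$. The form $q_K$ is called round if $D_K(q)$ is a subgroup of $K^{\times}$ and $D_K(q)=G_K(q)$. For $n\geqslant 0$, an $n$-fold Pfister form over $F$ is a form isometric to $\langle 1,a_1\rangle\otimes\cdots\otimes\langle 1,a_n\rangle$ for some $a_1,\ldots,a_n\in F^{\times}$ (for $n=0$ this is the form $\langle 1\rangle$), and a Pfister form over $F$ is an $n$-fold Pfister form for some $n\geqslant 0$. Two forms $p$ and $p'$ over $F$ are called similar if $p\simeq ap'$ for some $a\in F^{\times}$. The following are equivalent: (i) $q$ is similar to a Pfister form over $F$; (ii) $q_K$ is round for every field extension $K/F$ such that $1\in D_K(q)$; (iii) $q_K$ is round for every field extension $K/F$ such that $q_K$ is isotropic (that is, such that $q_K(v)=0$ for some nonzero vector $v$). -/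

import Mathlib

open scoped TensorProduct

universe u v w

namespace QuadExt

section Basic

variable {F : Type u} [Field F] {V : Type v} [AddCommGroup V] [Module F V]
  {W : Type w} [AddCommGroup W] [Module F W]

/-- The value set `D_F(q)`: the elements of `Fˣ` represented by `q`. -/
def valueSet (q : QuadraticForm F V) : Set Fˣ :=
  {a | ∃ x : V, q x = (a : F)}

/-- The set `G_F(q)` of similarity factors of `q`: those `a` in `Fˣ` with `aq` isometric to `q`. -/
def similarityFactors (q : QuadraticForm F V) : Set Fˣ :=
  {a | QuadraticMap.Equivalent ((a : F) • q) q}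

/-- `q` is a group form if `D_F(q)` is a subgroup of `Fˣ`. -/
def IsGroupForm (q : QuadraticForm F V) : Prop :=
  ∃ H : Subgroup Fˣ, (H : Set Fˣ) = valueSet q

/-- A group form `q` is round if `D_F(q) = G_F(q)`. -/
def IsRound (q : QuadraticForm F V) : Prop :=
  IsGroupForm q ∧ valueSet q = similarityFactors q

/-- `q` is isotropic if it represents zero non-trivially. -/
def IsIsotropic (q : QuadraticForm F V) : Prop :=
  ∃ x : V, x ≠ 0 ∧ q x = 0

/-- `p` and `q` are similar if `p` is isometric to `aq` for some `a` in `Fˣ`. -/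
def Similar (p : QuadraticForm F V) (q : QuadraticForm F W) : Prop :=
  ∃ a : Fˣ, QuadraticMap.Equivalent p ((a : F) • q)

end Basic

section Pfister

variable {F : Type u} [Field F] [Invertible (2 : F)]

/-- The tensor product `⟨1, a₁⟩ ⊗ (⟨1, a₂⟩ ⊗ ( ⋯ ⊗ (⟨1, aₙ⟩ ⊗ ⟨1⟩)))`, as a quadratic space
over `F`; for the empty list it is `⟨1⟩`. -/
noncomputable def pfisterSpace : List Fˣ → QuadraticModuleCat.{u} F
  | [] => QuadraticModuleCat.of (QuadraticMap.weightedSumSquares F ![(1 : F)])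
  | a :: l => QuadraticModuleCat.of
      (QuadraticForm.tmul (QuadraticMap.weightedSumSquares F ![(1 : F), (a : F)])
        (pfisterSpace l).form)

/-- `q` is an `n`-fold Pfister form: it is isometric to `⟨1, a₁⟩ ⊗ ⋯ ⊗ ⟨1, aₙ⟩` for some
`a₁, …, aₙ` in `Fˣ`. -/
def IsNFoldPfister {V : Type v} [AddCommGroup V] [Module F V] (n : ℕ)
    (q : QuadraticForm F V) : Prop :=
  ∃ l : List Fˣ, l.length = n ∧ QuadraticMap.Equivalent q (pfisterSpace l).form

/-- `q` is similar to an `n`-fold Pfister form for some `n ≥ 0`. Forms that are similar live on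
isomorphic spaces, so the Pfister form may be taken on the space of `q` itself. -/
def IsSimilarToPfister {V : Type v} [AddCommGroup V] [Module F V]
    (q : QuadraticForm F V) : Prop :=
  ∃ (n : ℕ) (p : QuadraticForm F V), IsNFoldPfister n p ∧ Similar q p

end Pfister

end QuadExt

namespace QuadExt

/-! ### Roundness, similarity factors and ratios of self-similarities -/

section Round

variable {K : Type*} [Field K] {M N : Type*} [AddCommGroup M] [Module K M]
  [AddCommGroup N] [Module K N]

/-! A Pfister form π has every nonzero value as a similarity factor, over every extension. This
passes from Q to Q ⟂ aQ by an explicit formula (`ValuesAreRatios.prod_smul`). If q ≃ aπ represents 1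
over K, then its values there are values of π, so q_K is round: (i) gives (ii). A nondegenerate
isotropic form is universal, so (ii) gives (iii).

For (iii) ⇒ (i), scale q so that q(e) = 1. Let L/F keep q anisotropic and let d = q(x) ≠ 0 with x
not proportional to e. The polynomial q(x - Te) = T² - tT + d has no root in L. Adjoining a root α
makes x - αe isotropic, so q becomes round and universal and α is a similarity factor. The norm
principle `isRatio_norm` descends this to its norm d. Hence all nonzero values of q_L are similarity
factors (`valuesAreRatios_of_anisotropic`).

Now grow a Pfister subform π of q, beginning with ⟨1⟩. If q ≃ π ⟂ r and b is a coefficient of r,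
then over such L a value A + bB of π ⟂ bπ with B ≠ 0 equals B(A/B + b), a product of two values of
q, because A/B is again a value of π. The subform theorem `embeds_of_values`, which rests on the
Cassels-Pfister theorem, then embeds π ⟂ bπ in q. The complement shrinks until q itself is Pfister.
-/

theorem equivalent_smul {Q : QuadraticForm K M} {Q' : QuadraticForm K N} (h : Q.Equivalent Q')
    (a : K) : (a • Q).Equivalent (a • Q') := by
  obtain ⟨e⟩ := h
  exact ⟨⟨e.toLinearEquiv, fun m => by
    have := e.map_app m
    simp only [smul_apply]
    rw [← this]; rfl⟩⟩

theorem valueSet_congr {Q : QuadraticForm K M} {Q' : QuadraticForm K N} (h : Q.Equivalent Q') :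
    valueSet Q = valueSet Q' := by
  obtain ⟨e⟩ := h
  ext a
  constructor
  · rintro ⟨x, hx⟩
    exact ⟨e x, by rw [e.map_app, hx]⟩
  · rintro ⟨x, hx⟩
    exact ⟨e.symm x, by rw [e.symm.map_app, hx]⟩

theorem similarityFactors_congr {Q : QuadraticForm K M} {Q' : QuadraticForm K N}
    (h : Q.Equivalent Q') : similarityFactors Q = similarityFactors Q' := by
  ext a
  exact ⟨fun H => (equivalent_smul h.symm a).trans (H.trans h),
    fun H => (equivalent_smul h a).trans (H.trans h.symm)⟩

theorem isRound_congr {Q : QuadraticForm K M} {Q' : QuadraticForm K N} (h : Q.Equivalent Q') :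
    IsRound Q ↔ IsRound Q' := by
  unfold IsRound IsGroupForm
  rw [valueSet_congr h, similarityFactors_congr h]

theorem isIsotropic_congr {Q : QuadraticForm K M} {Q' : QuadraticForm K N}
    (h : Q.Equivalent Q') (hQ : IsIsotropic Q) : IsIsotropic Q' := by
  obtain ⟨e⟩ := h
  obtain ⟨x, hx, hx0⟩ := hQ
  refine ⟨e x, fun h0 => hx ?_, by rw [e.map_app, hx0]⟩
  exact e.toLinearEquiv.map_eq_zero_iff.mp h0

/-- The subgroup of similarity factors of a quadratic form. -/
def similaritySubgroup (Q : QuadraticForm K M) : Subgroup Kˣ where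
  carrier := similarityFactors Q
  one_mem' := by
    change QuadraticMap.Equivalent _ _
    rw [Units.val_one, one_smul]
  mul_mem' {a b} ha hb := by
    change QuadraticMap.Equivalent _ _
    rw [Units.val_mul, mul_smul]
    exact (equivalent_smul hb _).trans ha
  inv_mem' {a} ha := by
    have := (equivalent_smul (show QuadraticMap.Equivalent _ _ from ha) ((a⁻¹ : Kˣ) : K)).symm
    rw [smul_smul, ← Units.val_mul, inv_mul_cancel, Units.val_one, one_smul] at this
    exact this

/-- Similarity factors always form a group, and applying a similarity to a vector of value 1 makes
each factor a value. -/
theorem isRound_of_subset {Q : QuadraticForm K M} (h1 : 1 ∈ valueSet Q)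
    (h : valueSet Q ⊆ similarityFactors Q) : IsRound Q := by
  have heq : valueSet Q = similarityFactors Q := by
    refine Set.Subset.antisymm h ?_
    rintro a ⟨e⟩
    obtain ⟨x, hx⟩ := h1
    refine ⟨e x, ?_⟩
    rw [e.map_app, smul_apply, hx, Units.val_one, smul_eq_mul, mul_one]
  exact ⟨⟨similaritySubgroup Q, heq.symm⟩, heq⟩

/-- `d` is the ratio of a linear self-similarity of `Q`. -/
def IsRatio (Q : QuadraticForm K M) (d : K) : Prop :=
  ∃ T : M →ₗ[K] M, ∀ m, Q (T m) = d * Q m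

/-- Every nonzero value of `Q` is the ratio of a self-similarity. -/
def ValuesAreRatios (Q : QuadraticForm K M) : Prop :=
  ∀ x, Q x ≠ 0 → IsRatio Q (Q x)

theorem isRatio_of_mem {Q : QuadraticForm K M} {a : Kˣ} (h : a ∈ similarityFactors Q) :
    IsRatio Q a := by
  obtain ⟨e⟩ := h
  exact ⟨e.toLinearEquiv.toLinearMap, fun m => e.map_app m⟩

theorem polar_map_of_ratio {Q : QuadraticForm K M} {Q' : QuadraticForm K N} {d : K}
    {T : M →ₗ[K] N} (hT : ∀ m, Q' (T m) = d * Q m) (x y : M) :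
    QuadraticMap.polar Q' (T x) (T y) = d * QuadraticMap.polar Q x y := by
  simp only [QuadraticMap.polar, ← map_add, hT]
  ring

/-- Only the zero vector is orthogonal to everything. -/
def PolarNondegenerate (Q : QuadraticForm K M) : Prop :=
  ∀ x, (∀ y, QuadraticMap.polar Q x y = 0) → x = 0

/-- A vector in the kernel of T is orthogonal to everything, because T multiplies the polar form by
d ≠ 0. In finite dimension this makes self-similarities with nonzero ratio invertible, so `IsRatio`
need not ask for it. -/
theorem injective_of_ratio {Q : QuadraticForm K M} {Q' : QuadraticForm K N}
    (hQ : PolarNondegenerate Q) {d : K} (hd : d ≠ 0)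
    {T : M →ₗ[K] N} (hT : ∀ m, Q' (T m) = d * Q m) : Function.Injective T := by
  rw [injective_iff_map_eq_zero]
  intro x hx
  refine hQ x fun y => ?_
  have := polar_map_of_ratio hT x y
  rw [hx, QuadraticMap.polar_zero_left] at this
  exact (mul_eq_zero.mp this.symm).resolve_left hd

theorem mem_similarityFactors_of_isRatio [FiniteDimensional K M] {Q : QuadraticForm K M}
    (hQ : PolarNondegenerate Q) {a : Kˣ} (h : IsRatio Q a) : a ∈ similarityFactors Q := by
  obtain ⟨T, hT⟩ := h
  have hi := injective_of_ratio hQ a.ne_zero hT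
  exact ⟨⟨LinearEquiv.ofInjectiveEndo T hi, fun m => hT m⟩⟩

theorem isRound_of_valuesAreRatios [FiniteDimensional K M] {Q : QuadraticForm K M}
    (hQ : PolarNondegenerate Q) (h1 : 1 ∈ valueSet Q) (h : ValuesAreRatios Q) : IsRound Q := by
  refine isRound_of_subset h1 ?_
  rintro a ⟨x, hx⟩
  refine mem_similarityFactors_of_isRatio hQ ?_
  rw [← hx]
  exact h x (by rw [hx]; exact a.ne_zero)

theorem exists_eq_of_isIsotropic {Q : QuadraticForm K M} (hQ : PolarNondegenerate Q)
    (h : IsIsotropic Q) (a : K) : ∃ x, Q x = a := by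
  obtain ⟨x, hx, hx0⟩ := h
  obtain ⟨y, hy⟩ : ∃ y, QuadraticMap.polar Q x y ≠ 0 := by
    by_contra! H
    exact hx (hQ x H)
  -- Along the line y + s x the form is affine in s, with slope `polar Q x y`.
  refine ⟨((a - Q y) / QuadraticMap.polar Q x y) • x + y, ?_⟩
  rw [QuadraticMap.map_add Q, QuadraticMap.map_smul, QuadraticMap.polar_smul_left, hx0]
  simp only [smul_eq_mul]
  field_simp
  ring

end Round

/-! ### Diagonal forms, isometric embeddings and base change -/

section Diagonal

variable {F : Type*} [Field F] {ι κ : Type*} [Fintype ι] [Fintype κ]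

/-- The diagonal form over `K` whose coefficients are the `w i`, taken in a base field `F`. -/
noncomputable abbrev diag (K : Type*) [Field K] [Algebra F K] (w : ι → F) :
    QuadraticForm K (ι → K) :=
  QuadraticMap.weightedSumSquares K w

variable {K : Type*} [Field K] [Algebra F K]

theorem diag_smul (c : F) (w : ι → F) (x : ι → K) : diag K (c • w) x = c • diag K w x := by
  simp [Finset.smul_sum, mul_smul]

theorem diag_smul_eq (c : F) (w : ι → F) :
    diag K (c • w) = algebraMap F K c • diag K w := by
  ext x
  rw [diag_smul, Algebra.smul_def]
  rfl

theorem diag_sumElim (p : ι → F) (r : κ → F) (x : ι ⊕ κ → K) :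
    diag K (Sum.elim p r) x = diag K p (x ∘ Sum.inl) + diag K r (x ∘ Sum.inr) := by
  simp

theorem diag_algebraMap (w : ι → F) (x : ι → F) :
    diag K w (fun i => algebraMap F K (x i)) = algebraMap F K (diag F w x) := by
  simp [Algebra.smul_def]

theorem diag_algebraMap_tower {L : Type*} [Field L] [Algebra F L] [Algebra L K]
    [IsScalarTower F L K] (w : ι → F) (x : ι → L) :
    diag K w (fun i => algebraMap L K (x i)) = algebraMap L K (diag L w x) := by
  simp [Algebra.smul_def, IsScalarTower.algebraMap_apply F L K]

theorem polarNondegenerate_diag (h2 : (2 : F) ≠ 0) {w : ι → F} (hw : ∀ i, w i ≠ 0) :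
    PolarNondegenerate (diag K w) := by
  classical
  intro x hx
  ext i
  have h := hx (Pi.single i 1)
  have h2' : (2 : K) ≠ 0 := by
    rw [← map_ofNat (algebraMap F K)]
    exact (map_ne_zero _).mpr h2
  have hpol : QuadraticMap.polar (diag K w) x (Pi.single i 1) = w i • (2 * x i) := by
    simp only [QuadraticMap.polar, QuadraticMap.weightedSumSquares_apply, ← Finset.sum_sub_distrib]
    rw [Finset.sum_eq_single i]
    · simp only [Pi.add_apply, Pi.single_eq_same, Algebra.smul_def]
      ring
    · intro j _ hj
      simp [Pi.single_eq_of_ne hj]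
    · simp
  rw [hpol] at h
  simpa [hw i, h2'] using h

/-- `p` embeds isometrically, over the base field, into `v`. -/
def Embeds (p : κ → F) (v : ι → F) : Prop :=
  ∃ T : (κ → F) →ₗ[F] (ι → F), ∀ x, diag F v (T x) = diag F p x

theorem embeds_of_equivalent {p : κ → F} {v : ι → F}
    (h : QuadraticMap.Equivalent (diag F p) (diag F v)) : Embeds p v := by
  obtain ⟨e⟩ := h
  exact ⟨e.toLinearEquiv.toLinearMap, fun m => e.map_app m⟩

theorem embeds_inl (p : ι → F) (r : κ → F) : Embeds p (Sum.elim p r) := by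
  refine ⟨⟨⟨fun x => Sum.elim x 0, ?_⟩, ?_⟩, ?_⟩
  · intro x y; ext (i | i) <;> simp
  · intro c x; ext (i | i) <;> simp
  · intro x
    simp

theorem Embeds.trans {μ : Type*} [Fintype μ] {p : κ → F} {v : ι → F} {r : μ → F}
    (h : Embeds p v) (h' : Embeds v r) : Embeds p r := by
  obtain ⟨T, hT⟩ := h
  obtain ⟨S, hS⟩ := h'
  exact ⟨S ∘ₗ T, fun x => by rw [LinearMap.comp_apply, hS, hT]⟩

variable [Invertible (2 : F)]

theorem diag_piScalarRight [DecidableEq ι] (w : ι → F) (z : K ⊗[F] (ι → F)) :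
    diag K w (TensorProduct.piScalarRight F K K ι z) = (diag F w).baseChange K z := by
  have : (diag K w).comp (TensorProduct.piScalarRight F K K ι).toLinearMap
      = (diag F w).baseChange K := by
    refine baseChange_ext fun m => ?_
    simp [QuadraticMap.comp_apply, Algebra.smul_def]
  exact DFunLike.congr_fun this z

theorem Embeds.baseChange {p : κ → F} {v : ι → F} (h : Embeds p v)
    (K : Type*) [Field K] [Algebra F K] :
    ∃ T : (κ → K) →ₗ[K] (ι → K), ∀ x, diag K v (T x) = diag K p x := by
  classical
  obtain ⟨T, hT⟩ := h
  refine ⟨(TensorProduct.piScalarRight F K K ι).toLinearMap ∘ₗ T.baseChange K ∘ₗ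
    (TensorProduct.piScalarRight F K K κ).symm.toLinearMap, fun x => ?_⟩
  obtain ⟨z, rfl⟩ := (TensorProduct.piScalarRight F K K κ).surjective x
  simp only [LinearMap.comp_apply, LinearEquiv.coe_coe, LinearEquiv.symm_apply_apply,
    diag_piScalarRight]
  have : ((diag F v).baseChange K).comp (T.baseChange K) = (diag F p).baseChange K := by
    refine baseChange_ext fun m => ?_
    simp only [QuadraticMap.comp_apply, LinearMap.baseChange_tmul,
      QuadraticForm.baseChange_tmul, hT]
  exact DFunLike.congr_fun this z

theorem Embeds.anisotropic {p : κ → F} {v : ι → F} (h : Embeds p v) (hp : ∀ i, p i ≠ 0)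
    {K : Type*} [Field K] [Algebra F K] (hv : (diag K v).Anisotropic) :
    (diag K p).Anisotropic := by
  obtain ⟨T, hT⟩ := h.baseChange K
  have hi : Function.Injective T :=
    injective_of_ratio (polarNondegenerate_diag (Invertible.ne_zero (2 : F)) hp) one_ne_zero
      (d := (1 : K)) (fun m => by rw [hT, one_mul])
  intro x hx
  rw [← hT] at hx
  exact hi (by rw [hv _ hx, map_zero])

theorem equivalent_baseChange {V : Type*} [AddCommGroup V] [Module F V] {q : QuadraticForm F V}
    {w : ι → F} (h : q.Equivalent (diag F w)) (K : Type*) [Field K] [Algebra F K] :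
    (q.baseChange K).Equivalent (diag K w) := by
  classical
  obtain ⟨e⟩ := h
  refine ⟨⟨(e.toLinearEquiv.baseChange F K V (ι → F)).trans
    (TensorProduct.piScalarRight F K K ι), fun z => ?_⟩⟩
  have : ((diag F w).baseChange K).comp (e.toLinearEquiv.toLinearMap.baseChange K)
      = q.baseChange K := by
    refine baseChange_ext fun m => ?_
    have := e.map_app m
    simp only [QuadraticMap.comp_apply, LinearMap.baseChange_tmul,
      QuadraticForm.baseChange_tmul, LinearEquiv.coe_coe]
    rw [← this]; rfl
  refine Eq.trans ?_ (DFunLike.congr_fun this z)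
  exact diag_piScalarRight w _

end Diagonal

/-! ### Multiplicativity of Q ⟂ aQ -/

section Doubling

variable {K : Type*} [Field K] {M N : Type*} [AddCommGroup M] [Module K M]
  [AddCommGroup N] [Module K N]

/-- If the nonzero values of `Q` are ratios of self-similarities of `Q`, then the same holds for
`Q ⟂ aQ`. -/
theorem ValuesAreRatios.prod_smul {Q : QuadraticForm K M} (h : ValuesAreRatios Q) (a : K) :
    ValuesAreRatios (Q.prod (a • Q)) := by
  rintro ⟨u, v⟩ huv
  simp only [QuadraticMap.prod_apply, smul_apply, smul_eq_mul] at huv ⊢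
  -- A value 0 supplies no self-similarity, so the cases Q u = 0 and Q v = 0 need separate formulas.
  -- In the first the value is a·Q v, and the two summands are interchanged.
  by_cases hu : Q u = 0
  · rw [hu, zero_add] at huv ⊢
    obtain ⟨τ, hτ⟩ := h v (right_ne_zero_of_mul huv)
    refine ⟨(a • (τ ∘ₗ LinearMap.snd K M M)).prod (τ ∘ₗ LinearMap.fst K M M), ?_⟩
    rintro ⟨m, n⟩
    simp only [LinearMap.prod_apply, Function.prod, QuadraticMap.prod_apply, smul_apply,
      smul_eq_mul, LinearMap.smul_apply, LinearMap.comp_apply, LinearMap.fst_apply,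
      LinearMap.snd_apply, QuadraticMap.map_smul, hτ]
    ring
  obtain ⟨σ, hσ⟩ := h u hu
  by_cases hv : Q v = 0
  · refine ⟨(σ ∘ₗ LinearMap.fst K M M).prod (σ ∘ₗ LinearMap.snd K M M), ?_⟩
    rintro ⟨m, n⟩
    simp only [LinearMap.prod_apply, Function.prod, QuadraticMap.prod_apply, smul_apply,
      smul_eq_mul, LinearMap.comp_apply, LinearMap.fst_apply, LinearMap.snd_apply, hσ, hv]
    ring
  obtain ⟨τ, hτ⟩ := h v hv
  -- The coefficients make the polar terms of the two components equal to ∓a · polar(m, τσn), so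
  -- they cancel.
  refine ⟨(σ.coprod (-(a / Q u) • (σ ∘ₗ τ ∘ₗ σ))).prod
    (τ.coprod ((Q v)⁻¹ • (τ ∘ₗ τ ∘ₗ σ))), ?_⟩
  rintro ⟨m, n⟩
  simp only [LinearMap.prod_apply, Function.prod, QuadraticMap.prod_apply, smul_apply, smul_eq_mul,
    LinearMap.coprod_apply, LinearMap.smul_apply, LinearMap.comp_apply,
    QuadraticMap.map_add Q, QuadraticMap.map_smul, QuadraticMap.polar_smul_right,
    polar_map_of_ratio hσ m, polar_map_of_ratio hτ m, hσ, hτ]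
  field_simp
  ring

theorem ValuesAreRatios.congr {Q : QuadraticForm K M} {Q' : QuadraticForm K N}
    (e : Q'.Equivalent Q) (h : ValuesAreRatios Q) : ValuesAreRatios Q' := by
  obtain ⟨e⟩ := e
  intro x hx
  obtain ⟨T, hT⟩ := h (e x) (by rwa [e.map_app])
  refine ⟨e.symm.toLinearEquiv.toLinearMap ∘ₗ T ∘ₗ e.toLinearEquiv.toLinearMap, fun m => ?_⟩
  refine (e.symm.map_app _).trans ((hT _).trans ?_)
  rw [e.map_app]
  congr 1
  exact e.map_app m

/-- The values of a form with `ValuesAreRatios` are closed under multiplication. -/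
theorem ValuesAreRatios.exists_eq_mul {Q : QuadraticForm K M} (h : ValuesAreRatios Q) (x y : M) :
    ∃ z, Q z = Q x * Q y := by
  by_cases hx : Q x = 0
  · exact ⟨0, by simp [hx]⟩
  · obtain ⟨T, hT⟩ := h x hx
    exact ⟨T y, hT y⟩

/-- The values of a form with `ValuesAreRatios` are closed under division. -/
theorem ValuesAreRatios.exists_eq_div {Q : QuadraticForm K M} (h : ValuesAreRatios Q) (x y : M) :
    ∃ z, Q z = Q x / Q y := by
  obtain ⟨z, hz⟩ := h.exists_eq_mul x y
  refine ⟨(Q y)⁻¹ • z, ?_⟩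
  rw [QuadraticMap.map_smul, hz, smul_eq_mul]
  by_cases hy : Q y = 0
  · simp [hy]
  · field_simp

end Doubling

/-! ### Diagonalised Pfister forms -/

section Pfister

/-- An index type for the coefficients of a diagonalised Pfister form. -/
def PfisterIndex {α : Type*} : List α → Type
  | [] => Unit
  | _ :: l => PfisterIndex l ⊕ PfisterIndex l

instance PfisterIndex.fintype {α : Type*} : (l : List α) → Fintype (PfisterIndex l)
  | [] => inferInstanceAs (Fintype Unit)
  | _ :: l =>
    letI := PfisterIndex.fintype l
    inferInstanceAs (Fintype (PfisterIndex l ⊕ PfisterIndex l))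

variable {F : Type u} [Field F]

/-- The coefficients of a diagonalised Pfister form. -/
def pfisterCoeff : (l : List Fˣ) → PfisterIndex l → F
  | [] => fun _ => 1
  | a :: l => Sum.elim (pfisterCoeff l) ((a : F) • pfisterCoeff l)

theorem pfisterCoeff_ne_zero (l : List Fˣ) (i : PfisterIndex l) : pfisterCoeff l i ≠ 0 := by
  induction l with
  | nil => exact one_ne_zero
  | cons a l ih =>
    rcases i with i | i
    · exact ih i
    · exact mul_ne_zero a.ne_zero (ih i)

theorem diag_pfisterCoeff_nil {K : Type*} [Field K] [Algebra F K]
    (y : PfisterIndex ([] : List Fˣ) → K) :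
    diag K (pfisterCoeff ([] : List Fˣ)) y = y () * y () := by
  rw [QuadraticMap.weightedSumSquares_apply]
  exact (Fintype.sum_unique (ι := Unit) _).trans (by simp [pfisterCoeff])

theorem exists_diag_pfisterCoeff_eq_one (K : Type*) [Field K] [Algebra F K] (l : List Fˣ) :
    ∃ x, diag K (pfisterCoeff l) x = 1 := by
  induction l with
  | nil => exact ⟨fun _ => 1, by rw [diag_pfisterCoeff_nil, one_mul]⟩
  | cons a l ih =>
    obtain ⟨x, hx⟩ := ih
    refine ⟨Sum.elim x 0, ?_⟩
    refine (diag_sumElim (pfisterCoeff l) ((a : F) • pfisterCoeff l) _).trans ?_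
    rw [Sum.elim_comp_inl, Sum.elim_comp_inr, hx, map_zero, add_zero]

theorem equivalent_diag_sumElim {K : Type*} [Field K] [Algebra F K] {ι κ : Type*} [Fintype ι]
    [Fintype κ] (p : ι → F) (r : κ → F) :
    QuadraticMap.Equivalent (diag K (Sum.elim p r)) ((diag K p).prod (diag K r)) :=
  ⟨⟨LinearEquiv.sumArrowLequivProdArrow ι κ K K, fun x => (diag_sumElim p r x).symm⟩⟩

theorem equivalent_diag_sumElim_smul {K : Type*} [Field K] [Algebra F K] {ι : Type*} [Fintype ι]
    (p : ι → F) (a : F) :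
    QuadraticMap.Equivalent (diag K (Sum.elim p (a • p)))
      ((diag K p).prod (algebraMap F K a • diag K p)) :=
  ⟨⟨LinearEquiv.sumArrowLequivProdArrow ι ι K K, fun x => by
    rw [diag_sumElim, diag_smul, Algebra.smul_def]
    rfl⟩⟩

/-- Iterate the doubling from ⟨1⟩, where the value x² is the ratio of scaling by x. Anisotropy plays
no role, so this applies over every extension. -/
theorem valuesAreRatios_pfisterCoeff (K : Type*) [Field K] [Algebra F K] (l : List Fˣ) :
    ValuesAreRatios (diag K (pfisterCoeff l)) := by
  induction l with
  | nil =>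
    intro x _
    refine ⟨x () • LinearMap.id, fun m => ?_⟩
    rw [LinearMap.smul_apply, LinearMap.id_apply, QuadraticMap.map_smul, diag_pfisterCoeff_nil x, smul_eq_mul]
  | cons a l ih =>
    exact (ih.prod_smul _).congr (equivalent_diag_sumElim_smul (pfisterCoeff l) (a : F))

variable [Invertible (2 : F)]

theorem tmul_comp_basis_expansion {M : Type*} [AddCommGroup M] [Module F M]
    (Q : QuadraticForm F M) (a : F) (m n : M) :
    QuadraticForm.tmul (QuadraticMap.weightedSumSquares F ![(1 : F), a]) Q
      (Pi.single 0 1 ⊗ₜ m + Pi.single 1 1 ⊗ₜ n) = Q m + a * Q n := by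
  have hpol : QuadraticMap.polar (QuadraticForm.tmul
      (QuadraticMap.weightedSumSquares F ![(1 : F), a]) Q)
      (Pi.single 0 1 ⊗ₜ m) (Pi.single 1 1 ⊗ₜ n) = 0 := by
    have h := LinearMap.congr_fun (LinearMap.congr_fun (QuadraticForm.polarBilin_tmul (A := F)
      (QuadraticMap.weightedSumSquares F ![(1 : F), a]) Q)
      (Pi.single 0 1 ⊗ₜ m)) (Pi.single 1 1 ⊗ₜ n)
    refine h.trans ?_
    simp [QuadraticMap.polar]
  rw [QuadraticMap.map_add (QuadraticForm.tmul _ _), hpol]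
  simp [mul_comm]

theorem tmul_equivalent_prod {M : Type*} [AddCommGroup M] [Module F M]
    (Q : QuadraticForm F M) (a : F) :
    (QuadraticForm.tmul (QuadraticMap.weightedSumSquares F ![(1 : F), a]) Q).Equivalent
      (Q.prod (a • Q)) := by
  let e : ((Fin 2 → F) ⊗[F] M) ≃ₗ[F] (M × M) :=
    (TensorProduct.comm F (Fin 2 → F) M).trans
      ((TensorProduct.piScalarRight F F M (Fin 2)).trans (LinearEquiv.finTwoArrow F M))
  have he : ∀ m n, e (Pi.single 0 1 ⊗ₜ m + Pi.single 1 1 ⊗ₜ n) = (m, n) := by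
    intro m n
    simp [e]
  refine QuadraticMap.Equivalent.symm ⟨⟨e.symm, fun x => ?_⟩⟩
  have hx : e.symm x = Pi.single 0 1 ⊗ₜ x.1 + Pi.single 1 1 ⊗ₜ x.2 := by
    rw [LinearEquiv.symm_apply_eq, he]
  refine (congrArg _ hx).trans ?_
  rw [tmul_comp_basis_expansion]
  simp

theorem pfisterSpace_equivalent (l : List Fˣ) :
    (pfisterSpace l).form.Equivalent (diag F (pfisterCoeff l)) := by
  induction l with
  | nil =>
    refine ⟨⟨LinearEquiv.funCongrLeft F F (Equiv.ofUnique Unit (Fin 1)), fun x => ?_⟩⟩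
    refine (diag_pfisterCoeff_nil _).trans ?_
    refine Eq.trans ?_ (QuadraticMap.weightedSumSquares_apply ![(1 : F)] x).symm
    simp
    rfl
  | cons a l ih =>
    refine (tmul_equivalent_prod (pfisterSpace l).form (a : F)).trans ?_
    refine (ih.prod (equivalent_smul ih _)).trans ?_
    exact (equivalent_diag_sumElim_smul (pfisterCoeff l) (a : F)).symm

end Pfister

/-! ### Norm principle for quadratic extensions -/

section Norm

variable {F L K : Type*} [Field F] [Field L] [Field K] [Algebra F L] [Algebra F K] [Algebra L K]
  [IsScalarTower F L K] {ι : Type*} [Fintype ι]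

theorem diag_add_mul (v : ι → F) (α : K) (x y : ι → L) :
    diag K v (fun i => algebraMap L K (x i) + α * algebraMap L K (y i)) =
      algebraMap L K (diag L v x) + α * α * algebraMap L K (diag L v y)
        + α * algebraMap L K (QuadraticMap.polar (diag L v) x y) := by
  have hp : QuadraticMap.polar (diag K v) (fun i => algebraMap L K (x i))
      (fun i => algebraMap L K (y i)) = algebraMap L K (QuadraticMap.polar (diag L v) x y) := by
    have h := diag_algebraMap_tower (K := K) v (x + y)
    simp only [Pi.add_apply, map_add] at h
    rw [QuadraticMap.polar, QuadraticMap.polar, map_sub, map_sub, ← h,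
      ← diag_algebraMap_tower (K := K) v x, ← diag_algebraMap_tower (K := K) v y]
    rfl
  have : (fun i => algebraMap L K (x i) + α * algebraMap L K (y i)) =
      (fun i => algebraMap L K (x i)) + α • (fun i => algebraMap L K (y i)) := rfl
  rw [this, QuadraticMap.map_add (diag K v), QuadraticMap.map_smul,
    QuadraticMap.polar_smul_right, hp, diag_algebraMap_tower, diag_algebraMap_tower]
  rfl

/-- Norm principle for a quadratic extension `K/L` and a form which is anisotropic over `L`:
if a generator `α` with minimal polynomial `T² - tT + d` is the ratio of a self-similarity over
`K`, then its norm `d` is the ratio of a self-similarity over `L`. -/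
theorem isRatio_norm {v : ι → F} (hL : (diag L v).Anisotropic) {α : K} {t d : L} (hd : d ≠ 0)
    (hα : α * α = algebraMap L K t * α - algebraMap L K d) (s₀ s₁ : K →ₗ[L] L)
    (hs : ∀ k, k = algebraMap L K (s₀ k) + α * algebraMap L K (s₁ k))
    (hs₀ : ∀ a b, s₀ (algebraMap L K a + α * algebraMap L K b) = a)
    (h : IsRatio (diag K v) α) : IsRatio (diag L v) d := by
  obtain ⟨σ, hσ⟩ := h
  have hα0 : α ≠ 0 := by
    rintro rfl
    have : algebraMap L K d = 0 := by simpa using hα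
    exact hd ((map_eq_zero _).mp this)
  let E : (ι → L) →ₗ[L] (ι → K) := (Algebra.linearMap L K).compLeft ι
  -- X and Y are the coordinates, in the L-basis 1, α of K, of the similarity σ restricted to
  -- L-rational vectors.
  let X : (ι → L) →ₗ[L] (ι → L) := s₀.compLeft ι ∘ₗ σ.restrictScalars L ∘ₗ E
  let Y : (ι → L) →ₗ[L] (ι → L) := s₁.compLeft ι ∘ₗ σ.restrictScalars L ∘ₗ E
  have hE : ∀ u, diag K v (E u) = algebraMap L K (diag L v u) := diag_algebraMap_tower v
  have hXY : ∀ u, σ (E u) = fun i => algebraMap L K (X u i) + α * algebraMap L K (Y u i) :=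
    fun u => funext fun i => hs _
  have hval : ∀ u, diag L v (X u) = d * diag L v (Y u) := by
    intro u
    have h1 := hσ (E u)
    rw [hXY, diag_add_mul, hE, hα] at h1
    have h2 : algebraMap L K (diag L v (X u) - d * diag L v (Y u)) + α * algebraMap L K
        (t * diag L v (Y u) + QuadraticMap.polar (diag L v) (X u) (Y u)) =
        algebraMap L K 0 + α * algebraMap L K (diag L v u) := by
      rw [← h1]
      simp only [map_sub, map_mul, map_add, map_zero]
      ring
    -- Only the constant coefficients in the basis 1, α are compared.
    have h3 := congrArg s₀ h2
    rw [hs₀, hs₀] at h3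
    linear_combination h3
  have hX : Function.Injective X := by
    rw [injective_iff_map_eq_zero]
    intro u hu
    have h1 : Y u = 0 := by
      apply hL
      have := hval u
      rw [hu, map_zero] at this
      exact (mul_eq_zero.mp this.symm).resolve_left hd
    have h2 := hσ (E u)
    have h3 : σ (E u) = 0 := by
      rw [hXY, hu, h1]
      ext i
      simp
    rw [h3, map_zero, hE] at h2
    exact hL u ((map_eq_zero _).mp ((mul_eq_zero.mp h2.symm).resolve_left hα0))
  let e := LinearEquiv.ofInjectiveEndo X hX
  -- Since q(Xu) = d q(Yu), the map dY∘X⁻¹ multiplies q by d² · d⁻¹ = d.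
  refine ⟨d • (Y ∘ₗ e.symm.toLinearMap), fun m => ?_⟩
  obtain ⟨u, rfl⟩ := e.surjective m
  have h1 : e u = X u := rfl
  rw [LinearMap.smul_apply, LinearMap.comp_apply, LinearEquiv.coe_coe,
    LinearEquiv.symm_apply_apply, QuadraticMap.map_smul, h1, hval, smul_eq_mul]
  ring

end Norm

/-! ### From isotropic extensions to anisotropic ones -/

section IsotropicExtensions

variable {F : Type u} [Field F] {ι : Type*} [Fintype ι]

/-- Over every extension where the form becomes isotropic, all nonzero scalars are ratios. -/
def AllRatiosWhenIsotropic (v : ι → F) : Prop :=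
  ∀ (K : Type (max u w)) [Field K] [Algebra F K], IsIsotropic (diag K v) →
    ∀ a : K, a ≠ 0 → IsRatio (diag K v) a

theorem valuesAreRatios_of_anisotropic {v : ι → F} (hv : AllRatiosWhenIsotropic.{u, w} v)
    {e : ι → F} (he : diag F v e = 1) (L : Type u) [Field L] [Algebra F L]
    (hL : (diag L v).Anisotropic) : ValuesAreRatios (diag L v) := by
  intro x hx
  set e' : ι → L := fun i => algebraMap F L (e i) with he'
  have he1 : diag L v e' = 1 := by rw [he', diag_algebraMap, he, map_one]
  -- A multiple s e' has value s², the ratio of scaling by s; no extension is needed.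
  by_cases hxe : ∃ s : L, x = s • e'
  · obtain ⟨s, rfl⟩ := hxe
    refine ⟨s • LinearMap.id, fun m => ?_⟩
    rw [LinearMap.smul_apply, LinearMap.id_apply, QuadraticMap.map_smul, QuadraticMap.map_smul,
      he1, smul_eq_mul, smul_eq_mul, mul_one]
  set t := QuadraticMap.polar (diag L v) x e' with ht
  set d := diag L v x with hd
  have hval : ∀ s : L, diag L v (x + (-s) • e') = s * s - t * s + d := by
    intro s
    rw [QuadraticMap.map_add (diag L v), QuadraticMap.map_smul, QuadraticMap.polar_smul_right, he1,
      ← ht, ← hd]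
    simp only [smul_eq_mul]
    ring
  -- A root r would make x - r e' isotropic over L, forcing x = r e'. Irreducibility is what turns
  -- the quadratic algebra into a field.
  have hroot : Fact (∀ r : L, r ^ 2 ≠ -d + t * r) := by
    refine ⟨fun r hr => hxe ⟨r, ?_⟩⟩
    have h0 := hL _ ((hval r).trans (by linear_combination hr))
    rwa [neg_smul, ← sub_eq_add_neg, sub_eq_zero] at h0
  let A := QuadraticAlgebra L (-d) t
  -- The lift only moves the extension into the universe over which `hv` quantifies.
  let K := ULift.{w} A
  let α : K := ULift.up QuadraticAlgebra.omega
  let down : K ≃ₗ[L] A := ULift.moduleEquiv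
  have hmap : ∀ a : L, algebraMap L K a = ULift.up (⟨a, 0⟩ : A) := fun a => rfl
  have hdown : ∀ a b : L, algebraMap L K a + α * algebraMap L K b = ULift.up (⟨a, b⟩ : A) := by
    intro a b
    rw [hmap, hmap]
    refine congrArg ULift.up (?_ : (⟨a, 0⟩ : A) + QuadraticAlgebra.omega * ⟨b, 0⟩ = ⟨a, b⟩)
    rw [QuadraticAlgebra.omega_mul_mk]
    ext <;> simp
  have hα : α * α = algebraMap L K t * α - algebraMap L K d := by
    have h : α * α = ULift.up (⟨-d, t⟩ : A) :=
      congrArg ULift.up (QuadraticAlgebra.omega_mul_omega_eq_mk (a := -d) (b := t))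
    rw [h, ← hdown, map_neg]
    ring
  have hα0 : α ≠ 0 := by
    intro h
    have := congrArg (fun z : K => z.down.im) h
    simp [α] at this
  refine isRatio_norm (K := K) hL hx hα
    (QuadraticAlgebra.reₗ (a := -d) (b := t) ∘ₗ down.toLinearMap)
    (QuadraticAlgebra.imₗ (a := -d) (b := t) ∘ₗ down.toLinearMap) ?_ ?_ (hv K ?_ α hα0)
  · intro k
    rw [hdown]
    rfl
  · intro a b
    rw [hdown]
    rfl
  -- The vector x - αe' is isotropic; it is nonzero because its coordinate along 1 is x.
  · refine ⟨fun i => algebraMap L K (x i) + α * algebraMap L K ((-e') i), ?_, ?_⟩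
    · intro h
      have hx0 : x = 0 := by
        ext i
        have := congrFun h i
        rw [hdown] at this
        exact congrArg (fun z : K => z.down.re) this
      rw [hd, hx0, map_zero] at hx
      exact hx rfl
    · rw [diag_add_mul, QuadraticMap.map_neg, QuadraticMap.polar_neg_right, he1, ← ht, ← hd, hα,
        map_one, map_neg]
      ring

end IsotropicExtensions

/-! ### The Cassels-Pfister theorem and cancellation over L(t) -/

section CasselsPfister

open Polynomial

variable {F L : Type*} [Field F] [Field L] [Algebra F L] {ι : Type*} [Fintype ι]

/-- The diagonal form with coefficients `w` on vectors of polynomials. -/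
noncomputable abbrev polyDiag (L : Type*) [Field L] [Algebra F L] (w : ι → F) :
    QuadraticForm L[X] (ι → L[X]) :=
  QuadraticMap.weightedSumSquares L[X] w

theorem coeff_polyDiag (w : ι → F) {x : ι → L[X]} {N : ℕ} (hN : ∀ i, (x i).natDegree ≤ N) :
    (polyDiag L w x).coeff (N + N) = diag L w (fun i => (x i).coeff N) := by
  simp [coeff_mul_add_eq_of_natDegree_le (hN _) (hN _)]

theorem natDegree_polyDiag_le (w : ι → F) {x : ι → L[X]} {N : ℕ}
    (hN : ∀ i, (x i).natDegree ≤ N) : (polyDiag L w x).natDegree ≤ N + N := by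
  rw [QuadraticMap.weightedSumSquares_apply]
  refine natDegree_sum_le_of_forall_le _ _ fun i _ => ?_
  exact (natDegree_smul_le _ _).trans (natDegree_mul_le_of_le (hN i) (hN i))

theorem eval_polyDiag (w : ι → F) (x : ι → L[X]) (c : L) :
    (polyDiag L w x).eval c = diag L w (fun i => (x i).eval c) := by
  simp [eval_finsetSum]

/-- Top-degree terms cannot cancel: if N is the largest degree among the entries, the coefficient at
2N is the value of an anisotropic form at a nonzero vector. -/
theorem natDegree_le_of_natDegree_polyDiag_le {w : ι → F} (hw : (diag L w).Anisotropic)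
    {x : ι → L[X]} {M : ℕ} (h : (polyDiag L w x).natDegree ≤ M + M) (i : ι) :
    (x i).natDegree ≤ M := by
  obtain ⟨j, -, hj⟩ := Finset.exists_max_image Finset.univ (fun i => (x i).natDegree)
    ⟨i, Finset.mem_univ i⟩
  refine (hj i (Finset.mem_univ i)).trans ?_
  by_contra! hlt
  have h1 := coeff_polyDiag w (fun i => hj i (Finset.mem_univ i))
  rw [coeff_eq_zero_of_natDegree_lt (by omega)] at h1
  have h2 := congrFun (hw _ h1.symm) j
  simp only [coeff_natDegree, Pi.zero_apply, leadingCoeff_eq_zero] at h2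
  rw [h2, natDegree_zero] at hlt
  omega

theorem polyDiag_anisotropic {w : ι → F} (hw : (diag L w).Anisotropic) :
    (polyDiag L w).Anisotropic := by
  intro x hx
  have h0 : ∀ i, (x i).natDegree ≤ 0 := natDegree_le_of_natDegree_polyDiag_le hw (by simp [hx])
  have h1 := coeff_polyDiag w h0
  rw [hx, coeff_zero] at h1
  have h2 := hw _ h1.symm
  ext1 i
  rw [eq_C_of_natDegree_le_zero (h0 i), congrFun h2 i]
  simp

/-- Cassels' descent: the line through v/h and its polynomial part y meets the quadric Q = f in a
second point, with denominator a h + b. Since h(a h + b) = Q(r) for the remainder r, and r has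
smaller degree than h, the denominator drops in degree. -/
theorem exists_polyDiag_eq_of_mul_sq {w : ι → F} (hw : (diag L w).Anisotropic) (f : L[X])
    {h : L[X]} (hh : h ≠ 0) {v : ι → L[X]} (hv : polyDiag L w v = f * h ^ 2) :
    ∃ y, polyDiag L w y = f := by
  induction hn : h.natDegree using Nat.strong_induction_on generalizing h v with
  | _ n ih =>
  set Q := polyDiag L w with hQ
  let y : ι → L[X] := fun i => v i / h
  let r : ι → L[X] := fun i => v i % h
  have hvr : v = h • y + r := by
    ext1 i
    exact (EuclideanDomain.div_add_mod (v i) h).symm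
  have hr : r = v + (-h) • y := by rw [hvr]; module
  by_cases hr0 : r = 0
  · refine ⟨y, ?_⟩
    rw [hvr, hr0, add_zero, QuadraticMap.map_smul, smul_eq_mul] at hv
    have : h ^ 2 ≠ 0 := pow_ne_zero 2 hh
    exact mul_left_cancel₀ this (by linear_combination hv)
  set P := QuadraticMap.polar Q v y with hP
  set a := Q y - f with ha
  set b := 2 * f * h - P with hb
  have hQr : h * (a * h + b) = Q r := by
    rw [hr, QuadraticMap.map_add Q, QuadraticMap.map_smul, QuadraticMap.polar_smul_right, hv, ← hP,
      smul_eq_mul, smul_eq_mul, ha, hb]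
    ring
  have hQr0 : Q r ≠ 0 := fun h0 => hr0 (polyDiag_anisotropic hw _ h0)
  have hh' : a * h + b ≠ 0 := by
    intro h0
    rw [h0, mul_zero] at hQr
    exact hQr0 hQr.symm
  have hdeg : h.natDegree ≠ 0 := by
    intro h0
    refine hr0 (funext fun i => ?_)
    rw [natDegree_eq_zero] at h0
    obtain ⟨c, rfl⟩ := h0
    have hc : c ≠ 0 := by rintro rfl; simp at hh
    exact EuclideanDomain.mod_eq_zero.mpr (isUnit_C.mpr hc.isUnit).dvd
  have hrdeg : ∀ i, (r i).natDegree ≤ h.natDegree - 1 := by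
    intro i
    by_cases hi : r i = 0
    · rw [hi, natDegree_zero]; omega
    · have : (r i).degree < h.degree := EuclideanDomain.mod_lt (v i) hh
      have := natDegree_lt_natDegree hi this
      omega
  have hle := natDegree_polyDiag_le w hrdeg
  rw [← hQ, ← hQr, natDegree_mul hh hh'] at hle
  refine ih _ (by omega) hh' (v := a • v + b • y) ?_ rfl
  rw [QuadraticMap.map_add Q, QuadraticMap.map_smul, QuadraticMap.map_smul,
    QuadraticMap.polar_smul_right, QuadraticMap.polar_smul_left, hv, ← hP]
  simp only [smul_eq_mul]
  have hy : Q y = a + f := by rw [ha]; ring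
  have hP' : P = 2 * f * h - b := by rw [hb]; ring
  rw [hy, hP']
  ring

variable {K : Type*} [Field K] [Algebra F K] [Algebra L[X] K] [IsScalarTower F L[X] K]

theorem diag_algebraMap_poly (w : ι → F) (x : ι → L[X]) :
    diag K w (fun i => algebraMap L[X] K (x i)) = algebraMap L[X] K (polyDiag L w x) := by
  simp [Algebra.smul_def, IsScalarTower.algebraMap_apply F L[X] K]

variable [IsFractionRing L[X] K]

theorem exists_common_denominator (x : ι → K) :
    ∃ (h : L[X]) (v : ι → L[X]), h ≠ 0 ∧
      algebraMap L[X] K h • x = fun i => algebraMap L[X] K (v i) := by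
  obtain ⟨h, hh⟩ := IsLocalization.exist_integer_multiples_of_finite (nonZeroDivisors L[X]) x
  choose v hv using hh
  refine ⟨h, v, nonZeroDivisors.ne_zero h.2, funext fun i => ?_⟩
  rw [hv i, Pi.smul_apply, smul_eq_mul, Algebra.smul_def]

/-- The Cassels-Pfister theorem for anisotropic diagonal forms. -/
theorem exists_polyDiag_eq {w : ι → F} (hw : (diag L w).Anisotropic) (f : L[X]) {x : ι → K}
    (hx : diag K w x = algebraMap L[X] K f) : ∃ y, polyDiag L w y = f := by
  obtain ⟨h, v, hh, hv⟩ := exists_common_denominator (L := L) x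
  refine exists_polyDiag_eq_of_mul_sq hw f hh (v := v) (IsFractionRing.injective L[X] K ?_)
  rw [← diag_algebraMap_poly, ← hv, QuadraticMap.map_smul, hx, map_mul, map_pow, smul_eq_mul]
  ring

theorem anisotropic_of_isFractionRing {w : ι → F} (hw : (diag L w).Anisotropic) :
    (diag K w).Anisotropic := by
  intro x hx
  obtain ⟨h, v, hh, hv⟩ := exists_common_denominator (L := L) x
  have h1 : polyDiag L w v = 0 := by
    refine IsFractionRing.injective L[X] K ?_
    rw [← diag_algebraMap_poly, ← hv, QuadraticMap.map_smul, hx, smul_zero, map_zero]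
  have hv0 := polyDiag_anisotropic hw v h1
  rw [hv0] at hv
  have h2 : algebraMap L[X] K h • x = 0 := by
    rw [hv]; ext i; simp
  refine (smul_eq_zero.mp h2).resolve_left ?_
  exact (map_ne_zero_iff _ (IsFractionRing.injective L[X] K)).mpr hh

/-- If `b t² + d` is represented by `⟨b⟩ ⟂ r` over `L(t)`, then `d` is represented by `r`
over `L`. -/
theorem exists_diag_eq_of_cancel (h2 : (2 : L) ≠ 0) {b : F} {r : ι → F}
    (hw : (diag L (Sum.elim (fun _ : Fin 1 => b) r)).Anisotropic) {d : L} {x : Fin 1 ⊕ ι → K}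
    (hx : diag K (Sum.elim (fun _ : Fin 1 => b) r) x = algebraMap L[X] K (b • X ^ 2 + C d)) :
    ∃ z, diag L r z = d := by
  obtain ⟨y, hy⟩ := exists_polyDiag_eq hw _ hx
  have hdeg : (y (Sum.inl 0)).natDegree ≤ 1 := by
    refine natDegree_le_of_natDegree_polyDiag_le hw ?_ _
    rw [hy]
    refine natDegree_add_le_of_degree_le ((natDegree_smul_le _ _).trans ?_) (by simp)
    simp
  -- The first entry is linear, m t + n. Choose c with m c + n = c, or with c + n = -c when m = 1;
  -- evaluating at c then cancels the term b c².
  obtain ⟨c, hc⟩ : ∃ c, (y (Sum.inl 0)).eval c * (y (Sum.inl 0)).eval c = c * c := by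
    rw [eq_X_add_C_of_natDegree_le_one hdeg]
    set m := (y (Sum.inl 0)).coeff 1
    set n := (y (Sum.inl 0)).coeff 0
    simp only [eval_add, eval_mul, eval_C, eval_X]
    by_cases hm : m = 1
    · refine ⟨-n / 2, ?_⟩
      rw [hm]
      field_simp
      ring
    · have : 1 - m ≠ 0 := sub_ne_zero.mpr (Ne.symm hm)
      refine ⟨n / (1 - m), ?_⟩
      field_simp
      ring
  refine ⟨fun i => (y (Sum.inr i)).eval c, ?_⟩
  have h1 := congrArg (eval c) hy
  rw [eval_polyDiag, diag_sumElim] at h1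
  simp only [QuadraticMap.weightedSumSquares_apply, Finset.univ_unique, Finset.sum_singleton,
    Function.comp_apply, Fin.default_eq_zero, hc, eval_add, eval_smul, eval_mul, eval_X,
    eval_C, pow_two] at h1 ⊢
  exact add_left_cancel h1

end CasselsPfister

/-! ### Orthogonal complements of embedded forms -/

section Complement

variable {F : Type*} [Field F] {ι κ : Type*} [Fintype ι] [Fintype κ]

theorem ne_zero_of_anisotropic {w : ι → F} (h : (diag F w).Anisotropic) (i : ι) : w i ≠ 0 := by
  classical
  intro h0
  have h1 : diag F w (Pi.single i 1) = 0 := by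
    rw [QuadraticMap.weightedSumSquares_apply]
    refine Finset.sum_eq_zero fun j _ => ?_
    by_cases hj : j = i
    · subst hj; simp [h0]
    · simp [Pi.single_eq_of_ne hj]
  have := congrFun (h _ h1) i
  simp at this

theorem anisotropic_of_equivalent {M N : Type*} [AddCommGroup M] [Module F M]
    [AddCommGroup N] [Module F N] {Q : QuadraticForm F M} {Q' : QuadraticForm F N}
    (h : Q.Equivalent Q') (hQ : Q.Anisotropic) : Q'.Anisotropic := by
  obtain ⟨e⟩ := h
  intro x hx
  have h1 : e.symm x = 0 := hQ _ (by rw [e.symm.map_app, hx])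
  exact e.symm.toLinearEquiv.map_eq_zero_iff.mp h1

theorem anisotropic_of_sumElim {L : Type*} [Field L] [Algebra F L] {p : ι → F} {r : κ → F}
    (h : (diag L (Sum.elim p r)).Anisotropic) : (diag L r).Anisotropic := by
  intro x hx
  have h1 : Sum.elim (0 : ι → L) x = 0 := by
    apply h
    rw [diag_sumElim, Sum.elim_comp_inl, Sum.elim_comp_inr, map_zero, hx, add_zero]
  ext i
  exact congrFun h1 (Sum.inr i)

theorem exists_complement [Invertible (2 : F)] {v : ι → F} (hv : (diag F v).Anisotropic)
    {p : κ → F} (hp : ∀ i, p i ≠ 0) (h : Embeds p v) :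
    ∃ (n : ℕ) (r : Fin n → F), (diag F v).Equivalent (diag F (Sum.elim p r)) := by
  obtain ⟨T, hT⟩ := h
  have h2 : (2 : F) ≠ 0 := Invertible.ne_zero 2
  have hi : Function.Injective T :=
    injective_of_ratio (polarNondegenerate_diag h2 hp) one_ne_zero
      (d := (1 : F)) (fun m => by rw [hT, one_mul])
  let B : LinearMap.BilinForm F (ι → F) := (diag F v).polarBilin
  have hB : B.IsRefl := fun x y hxy => (QuadraticMap.polar_comm (diag F v) y x).trans hxy
  -- A vector of the image orthogonal to the image satisfies 2q(x) = 0, so anisotropy makes it zero.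
  have hcompl : IsCompl (LinearMap.range T) (B.orthogonal (LinearMap.range T)) := by
    rw [LinearMap.BilinForm.isCompl_orthogonal_iff_disjoint hB, Submodule.disjoint_def]
    intro x hx hx'
    have h1 : QuadraticMap.polar (diag F v) x x = 0 := hx' x hx
    rw [QuadraticMap.polar_self, nsmul_eq_mul] at h1
    exact hv x ((mul_eq_zero.mp h1).resolve_left (by exact_mod_cast h2))
  set W := B.orthogonal (LinearMap.range T) with hW
  let Q' : QuadraticForm F W := (diag F v).comp W.subtype
  obtain ⟨r, hr⟩ := QuadraticForm.equivalent_weightedSumSquares Q'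
  refine ⟨_, r, QuadraticMap.Equivalent.symm ?_⟩
  refine (equivalent_diag_sumElim p r).trans
    (((QuadraticMap.Equivalent.refl (diag F p)).prod hr.symm).trans ?_)
  have hval : ∀ z : (κ → F) × W, diag F v (T.coprod W.subtype z) = (diag F p).prod Q' z := by
    rintro ⟨x, y⟩
    have h0 : QuadraticMap.polar (diag F v) (T x) y = 0 := y.2 _ ⟨x, rfl⟩
    rw [LinearMap.coprod_apply, QuadraticMap.map_add (diag F v), Submodule.subtype_apply, h0,
      add_zero, hT]
    rfl
  have hbij : Function.Bijective (T.coprod W.subtype) := by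
    constructor
    · rw [injective_iff_map_eq_zero]
      rintro ⟨x, y⟩ hxy
      rw [LinearMap.coprod_apply, Submodule.subtype_apply] at hxy
      have hx : T x = 0 := by
        refine Submodule.disjoint_def.mp hcompl.disjoint _ ⟨x, rfl⟩ ?_
        rw [eq_neg_of_add_eq_zero_left hxy]
        exact W.neg_mem y.2
      rw [hx, zero_add] at hxy
      have hx0 : x = 0 := hi (by rw [hx, map_zero])
      rw [hx0, Prod.mk_eq_zero]
      exact ⟨rfl, Subtype.ext hxy⟩
    · rw [← LinearMap.range_eq_top, LinearMap.range_coprod, Submodule.range_subtype]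
      exact hcompl.sup_eq_top
  exact ⟨⟨LinearEquiv.ofBijective _ hbij, hval⟩⟩

theorem embeds_single {v : ι → F} {e : ι → F} {b : F} (he : diag F v e = b) {α : Type*}
    [Fintype α] [Unique α] : Embeds (fun _ : α => b) v := by
  refine ⟨LinearMap.toSpanSingleton F _ e ∘ₗ LinearMap.proj default, fun x => ?_⟩
  rw [LinearMap.comp_apply, LinearMap.proj_apply, LinearMap.toSpanSingleton_apply,
    QuadraticMap.map_smul, he, QuadraticMap.weightedSumSquares_apply, Fintype.sum_unique]
  simp [mul_comm]

theorem embeds_of_reindex {v : ι → F} {p : κ → F} {μ : Type*} [Fintype μ] (e : μ ≃ κ)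
    (h : Embeds (p ∘ e) v) : Embeds p v := by
  obtain ⟨T, hT⟩ := h
  refine ⟨T ∘ₗ (LinearEquiv.funCongrLeft F F e).toLinearMap, fun x => ?_⟩
  rw [LinearMap.comp_apply, hT]
  simp only [QuadraticMap.weightedSumSquares_apply]
  exact Fintype.sum_equiv e _ _ fun i => rfl

theorem diag_comp_equiv {L : Type*} [Field L] [Algebra F L] (p : κ → F) {μ : Type*} [Fintype μ]
    (e : μ ≃ κ) (x : μ → L) : diag L (p ∘ e) x = diag L p (x ∘ e.symm) := by
  simp only [QuadraticMap.weightedSumSquares_apply]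
  exact Fintype.sum_equiv e _ _ fun i => by simp

theorem Embeds.exists_diag_eq [Invertible (2 : F)] {v : ι → F} {p : κ → F} (h : Embeds p v)
    {L : Type*} [Field L] [Algebra F L] (x : κ → L) : ∃ y, diag L v y = diag L p x := by
  obtain ⟨T, hT⟩ := h.baseChange L
  exact ⟨T x, hT x⟩

end Complement

/-! ### The subform theorem and the growth of Pfister subforms -/

section Subform

variable {F : Type u} [Field F] [Invertible (2 : F)]

open Polynomial in
/-- The subform theorem, relative to the class of extensions over which a fixed form `v₀` is
anisotropic: if every value of `p` is a value of `v` over all these extensions, then `p` embeds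
in `v`. -/
theorem embeds_of_values {ι₀ : Type*} [Fintype ι₀] {v₀ : ι₀ → F} (h₀ : (diag F v₀).Anisotropic)
    {m : ℕ} {p : Fin m → F} (hp : ∀ i, p i ≠ 0) {ι : Type} [Fintype ι] {v : ι → F}
    (hv : ∀ (L : Type u) [Field L] [Algebra F L],
      (diag L v₀).Anisotropic → (diag L v).Anisotropic)
    (H : ∀ (L : Type u) [Field L] [Algebra F L], (diag L v₀).Anisotropic →
      ∀ x : Fin m → L, ∃ y, diag L v y = diag L p x) : Embeds p v := by
  induction m generalizing ι v with
  | zero => exact ⟨0, fun x => by simp⟩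
  | succ m ih =>
    obtain ⟨e, he⟩ := H F h₀ (Fin.cons 1 0)
    have he' : diag F v e = p 0 := by
      rw [he, QuadraticMap.weightedSumSquares_apply, Fin.sum_univ_succ]
      simp
    obtain ⟨n, r, ⟨E⟩⟩ := exists_complement (hv F h₀) (fun _ => hp 0)
      (embeds_single he' (α := Fin 1))
    have hE : Embeds v (Sum.elim (fun _ : Fin 1 => p 0) r) := embeds_of_equivalent ⟨E⟩
    have hE' : Embeds (Sum.elim (fun _ : Fin 1 => p 0) r) v := embeds_of_equivalent ⟨E.symm⟩
    have hne := ne_zero_of_anisotropic (anisotropic_of_equivalent ⟨E⟩ (hv F h₀))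
    have haniso : ∀ (L : Type u) [Field L] [Algebra F L], (diag L v₀).Anisotropic →
        (diag L (Sum.elim (fun _ : Fin 1 => p 0) r)).Anisotropic :=
      fun L _ _ hL => hE'.anisotropic hne (hv L hL)
    -- Induction passes from v to its complement r, while the class of extensions stays tied to
    -- `v₀`. That class is closed under L ↦ L(t), so the hypothesis may be used at p₀t² + (value of
    -- the tail), from which p₀t² is cancelled.
    obtain ⟨T, hT⟩ := ih (p := Fin.tail p) (fun i => hp _) (v := r)
      (fun L _ _ hL => anisotropic_of_sumElim (haniso L hL)) (by
        intro L _ _ hL x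
        let K := FractionRing L[X]
        have hK : (diag K v₀).Anisotropic := anisotropic_of_isFractionRing hL
        obtain ⟨y, hy⟩ := H K hK
          (Fin.cons (algebraMap L[X] K X) fun i => algebraMap L[X] K (C (x i)))
        obtain ⟨z, hz⟩ := hE.exists_diag_eq y
        have h2 : (2 : L) ≠ 0 := by
          rw [← map_ofNat (algebraMap F L)]
          exact (_root_.map_ne_zero _).mpr (Invertible.ne_zero 2)
        refine exists_diag_eq_of_cancel (K := K) h2 (haniso L hL) (x := z) ?_
        rw [hz, hy, QuadraticMap.weightedSumSquares_apply, Fin.sum_univ_succ]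
        simp only [Fin.cons_zero, Fin.cons_succ, QuadraticMap.weightedSumSquares_apply]
        simp only [Algebra.smul_def, IsScalarTower.algebraMap_apply F L[X] K,
          IsScalarTower.algebraMap_apply F L L[X], map_add, map_mul, map_sum,
          Polynomial.algebraMap_eq, Fin.tail, pow_two])
    obtain ⟨S, hS⟩ := hE'
    let T' : (Fin (m + 1) → F) →ₗ[F] (Fin 1 ⊕ Fin n → F) :=
      (LinearEquiv.sumArrowLequivProdArrow (Fin 1) (Fin n) F F).symm.toLinearMap ∘ₗ
        (LinearMap.pi fun _ => LinearMap.proj 0).prod (T ∘ₗ LinearMap.funLeft F F Fin.succ)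
    refine ⟨S ∘ₗ T', fun x => ?_⟩
    have hT' : T' x = Sum.elim (fun _ => x 0) (T (Fin.tail x)) := by
      ext (i | i) <;> rfl
    rw [LinearMap.comp_apply, hS, hT', diag_sumElim, Sum.elim_comp_inl, Sum.elim_comp_inr, hT]
    simp only [QuadraticMap.weightedSumSquares_apply, Fin.sum_univ_succ (n := m), Fin.tail]
    simp

/-- By the subform theorem only values matter, and A + bB = B(A/B + b): the first factor is a value
of the Pfister form, the second a value of that form plus ⟨b⟩. Both are values of v, whose values
are closed under products. -/
theorem embeds_pfisterCoeff_cons {ι : Type} [Fintype ι] {v : ι → F}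
    (h₀ : (diag F v).Anisotropic)
    (hv : ∀ (L : Type u) [Field L] [Algebra F L], (diag L v).Anisotropic →
      ValuesAreRatios (diag L v))
    {l : List Fˣ} {n : ℕ} {r : Fin n → F}
    (h : Embeds (Sum.elim (pfisterCoeff l) r) v) (i : Fin n) {b : Fˣ} (hb : r i = b) :
    Embeds (pfisterCoeff (b :: l)) v := by
  let e := (Fintype.equivFin (PfisterIndex (b :: l))).symm
  refine embeds_of_reindex e (embeds_of_values h₀ (fun j => pfisterCoeff_ne_zero _ _)
    (fun L _ _ hL => hL) ?_)
  intro L _ _ hL x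
  rw [show diag L (fun j => pfisterCoeff (b :: l) (e j)) x = _ from
    diag_comp_equiv (pfisterCoeff (b :: l)) e x]
  set z : PfisterIndex l ⊕ PfisterIndex l → L := x ∘ e.symm
  suffices H : ∀ X Y : PfisterIndex l → L, ∃ y, diag L v y =
      diag L (pfisterCoeff l) X + (b : F) • diag L (pfisterCoeff l) Y by
    obtain ⟨y, hy⟩ := H (z ∘ Sum.inl) (z ∘ Sum.inr)
    refine ⟨y, hy.trans ?_⟩
    rw [← diag_smul]
    exact (diag_sumElim (pfisterCoeff l) ((b : F) • pfisterCoeff l) z).symm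
  intro X Y
  have hpi : Embeds (pfisterCoeff l) v := (embeds_inl _ r).trans h
  by_cases hY : diag L (pfisterCoeff l) Y = 0
  · rw [hY, smul_zero, add_zero]
    exact hpi.exists_diag_eq X
  obtain ⟨Z, hZ⟩ := (valuesAreRatios_pfisterCoeff L l).exists_eq_div X Y
  obtain ⟨y₁, hy₁⟩ := hpi.exists_diag_eq Y
  obtain ⟨y₂, hy₂⟩ := h.exists_diag_eq (Sum.elim Z (Pi.single i (1 : L)))
  obtain ⟨y, hy⟩ := (hv L hL).exists_eq_mul y₁ y₂
  refine ⟨y, ?_⟩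
  have hr : diag L r (Pi.single i (1 : L)) = algebraMap F L b := by
    rw [QuadraticMap.weightedSumSquares_apply, Finset.sum_eq_single i]
    · simp [hb, Algebra.smul_def]
    · intro j _ hj
      simp [Pi.single_eq_of_ne hj]
    · simp
  rw [hy, hy₁, hy₂, diag_sumElim, Sum.elim_comp_inl, Sum.elim_comp_inr, hZ, hr, Algebra.smul_def]
  field_simp

/-- Start from the subform ⟨1⟩ and keep doubling; the induction is on the dimension of the
complement. -/
theorem exists_pfisterCoeff_equivalent {ι : Type} [Fintype ι] {v : ι → F}
    (h₀ : (diag F v).Anisotropic)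
    (hv : ∀ (L : Type u) [Field L] [Algebra F L], (diag L v).Anisotropic →
      ValuesAreRatios (diag L v))
    {e : ι → F} (he : diag F v e = 1) :
    ∃ l : List Fˣ, (diag F v).Equivalent (diag F (pfisterCoeff l)) := by
  have key : ∀ (n : ℕ) (l : List Fˣ) (r : Fin n → F),
      (diag F v).Equivalent (diag F (Sum.elim (pfisterCoeff l) r)) →
      ∃ l : List Fˣ, (diag F v).Equivalent (diag F (pfisterCoeff l)) := by
    intro n
    induction n using Nat.strong_induction_on with
    | _ n ih =>
    intro l r h
    rcases Nat.eq_zero_or_pos n with rfl | hn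
    · refine ⟨l, h.trans ⟨⟨LinearEquiv.funCongrLeft F F
        (Equiv.sumEmpty (PfisterIndex l) (Fin 0)).symm, fun x => ?_⟩⟩⟩
      rw [diag_sumElim]
      simp
    · let i : Fin n := ⟨0, hn⟩
      have hne := ne_zero_of_anisotropic (anisotropic_of_equivalent h h₀)
      let b : Fˣ := Units.mk0 (r i) (hne (Sum.inr i))
      obtain ⟨n', r', h'⟩ := exists_complement h₀ (pfisterCoeff_ne_zero (b :: l))
        (embeds_pfisterCoeff_cons h₀ hv (embeds_of_equivalent h.symm) i (b := b) rfl)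
      refine ih n' ?_ (b :: l) r' h'
      obtain ⟨E⟩ := h.symm.trans h'
      have hcard := E.toLinearEquiv.finrank_eq
      simp only [Module.finrank_fintype_fun_eq_card, Fintype.card_sum, Fintype.card_fin] at hcard
      have h1 : Fintype.card (PfisterIndex (b :: l)) =
          Fintype.card (PfisterIndex l) + Fintype.card (PfisterIndex l) :=
        Fintype.card_sum (α := PfisterIndex l) (β := PfisterIndex l)
      -- Strict decrease needs a nonempty Pfister block, which holds because the form represents 1.
      have h2 : 0 < Fintype.card (PfisterIndex l) := by
        obtain ⟨x, hx⟩ := exists_diag_pfisterCoeff_eq_one F l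
        rw [Fintype.card_pos_iff]
        by_contra hempty
        rw [not_nonempty_iff] at hempty
        simp at hx
      omega
  have h1 : Embeds (pfisterCoeff ([] : List Fˣ)) v := embeds_single he (α := Unit)
  obtain ⟨n, r, h⟩ := exists_complement h₀ (pfisterCoeff_ne_zero []) h1
  exact key n [] r h

end Subform

/-! ### The implications between the three conditions -/

section Equivalences

variable {F : Type u} [Field F] [Invertible (2 : F)] {V : Type v} [AddCommGroup V] [Module F V]

theorem isRound_baseChange_of_isSimilarToPfister {q : QuadraticForm F V}
    (h : IsSimilarToPfister q) (K : Type*) [Field K] [Algebra F K]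
    (h1 : (1 : Kˣ) ∈ valueSet (q.baseChange K)) : IsRound (q.baseChange K) := by
  obtain ⟨n, p, ⟨l, -, hp⟩, a, hq⟩ := h
  have hF : q.Equivalent (diag F ((a : F) • pfisterCoeff l)) := by
    rw [diag_smul_eq]
    exact hq.trans (equivalent_smul (hp.trans (pfisterSpace_equivalent l)) _)
  have hK := equivalent_baseChange hF K
  rw [isRound_congr hK]
  rw [valueSet_congr hK] at h1
  refine isRound_of_valuesAreRatios (polarNondegenerate_diag (Invertible.ne_zero (2 : F))
    fun i => mul_ne_zero a.ne_zero (pfisterCoeff_ne_zero l i)) h1 ?_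
  obtain ⟨x, hx⟩ := h1
  rw [Units.val_one, diag_smul_eq, smul_apply, smul_eq_mul] at hx
  rw [diag_smul_eq]
  intro y hy
  -- With aπ(x) = 1, the value aπ(y) equals π(y)/π(x), again a value of π. It is thus a ratio for π,
  -- and so for aπ.
  obtain ⟨z, hz⟩ := (valuesAreRatios_pfisterCoeff K l).exists_eq_div y x
  have hyz : (algebraMap F K a • diag K (pfisterCoeff l)) y = diag K (pfisterCoeff l) z := by
    have hx0 : diag K (pfisterCoeff l) x ≠ 0 := right_ne_zero_of_mul (hx ▸ one_ne_zero)
    rw [smul_apply, smul_eq_mul, hz, eq_div_iff hx0]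
    linear_combination diag K (pfisterCoeff l) y * hx
  rw [hyz] at hy ⊢
  obtain ⟨T, hT⟩ := valuesAreRatios_pfisterCoeff K l z hy
  refine ⟨T, fun m => ?_⟩
  rw [smul_apply, smul_apply, hT, smul_eq_mul, smul_eq_mul]
  ring

/-- An isotropic form is universal, so roundness turns every nonzero scalar into a similarity
factor; scaling the form by c changes neither isotropy nor ratios. -/
theorem allRatiosWhenIsotropic_of_isRound {q : QuadraticForm F V} {ι : Type*} [Fintype ι]
    {w : ι → F} (hw0 : ∀ i, w i ≠ 0) (hw : q.Equivalent (diag F w))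
    (h : ∀ (K : Type (max u w)) [Field K] [Algebra F K],
      IsIsotropic (q.baseChange K) → IsRound (q.baseChange K)) {c : F} (hc : c ≠ 0) :
    AllRatiosWhenIsotropic.{u, w} (c • w) := by
  intro K _ _ hiso a ha
  have hK := equivalent_baseChange hw K
  have hc' : algebraMap F K c ≠ 0 := (map_ne_zero _).mpr hc
  have hiso' : IsIsotropic (diag K w) := by
    obtain ⟨x, hx, hx0⟩ := hiso
    refine ⟨x, hx, ?_⟩
    rw [diag_smul_eq, smul_apply, smul_eq_mul] at hx0
    exact (mul_eq_zero.mp hx0).resolve_left hc'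
  have hround := h K (isIsotropic_congr hK.symm hiso')
  rw [isRound_congr hK] at hround
  have hmem : Units.mk0 a ha ∈ valueSet (diag K w) :=
    exists_eq_of_isIsotropic (polarNondegenerate_diag (Invertible.ne_zero (2 : F)) hw0) hiso' _
  rw [hround.2] at hmem
  obtain ⟨T, hT⟩ := isRatio_of_mem hmem
  refine ⟨T, fun m => ?_⟩
  rw [diag_smul_eq, smul_apply, smul_apply, hT, smul_eq_mul, smul_eq_mul, Units.val_mk0]
  ring

variable [FiniteDimensional F V]

theorem exists_equivalent_diag {q : QuadraticForm F V} (hq : q.Anisotropic) :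
    ∃ w : Fin (Module.finrank F V) → F, (∀ i, w i ≠ 0) ∧ q.Equivalent (diag F w) := by
  obtain ⟨w, hw⟩ := QuadraticForm.equivalent_weightedSumSquares q
  exact ⟨w, ne_zero_of_anisotropic (anisotropic_of_equivalent hw hq), hw⟩

theorem one_mem_valueSet_of_isIsotropic {q : QuadraticForm F V} (hq : q.Anisotropic) (K : Type*)
    [Field K] [Algebra F K] (h : IsIsotropic (q.baseChange K)) :
    (1 : Kˣ) ∈ valueSet (q.baseChange K) := by
  obtain ⟨w, hw0, hw⟩ := exists_equivalent_diag hq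
  have hK := equivalent_baseChange hw K
  rw [valueSet_congr hK]
  exact exists_eq_of_isIsotropic (polarNondegenerate_diag (Invertible.ne_zero (2 : F)) hw0)
    (isIsotropic_congr hK h) _

theorem isSimilarToPfister_of_isRound [Nontrivial V] {q : QuadraticForm F V}
    (hq : q.Anisotropic)
    (h : ∀ (K : Type (max u w)) [Field K] [Algebra F K],
      IsIsotropic (q.baseChange K) → IsRound (q.baseChange K)) : IsSimilarToPfister q := by
  obtain ⟨w, hw0, hw⟩ := exists_equivalent_diag hq
  let i : Fin (Module.finrank F V) := ⟨0, Module.finrank_pos⟩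
  -- Dividing by one diagonal coefficient makes 1 a value.
  let c : Fˣ := Units.mk0 (w i) (hw0 i)
  have hall := allRatiosWhenIsotropic_of_isRound.{u, v, w} hw0 hw h (c⁻¹ : Fˣ).ne_zero
  have hw' : (((c⁻¹ : Fˣ) : F) • q).Equivalent (diag F (((c⁻¹ : Fˣ) : F) • w)) := by
    rw [diag_smul_eq]
    exact equivalent_smul hw _
  have hq' : (((c⁻¹ : Fˣ) : F) • q).Anisotropic := by
    intro x hx
    rw [smul_apply, smul_eq_mul] at hx
    exact hq x ((mul_eq_zero.mp hx).resolve_left (c⁻¹ : Fˣ).ne_zero)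
  have haniso := anisotropic_of_equivalent hw' hq'
  have he : diag F (((c⁻¹ : Fˣ) : F) • w) (Pi.single i 1) = 1 := by
    rw [QuadraticMap.weightedSumSquares_apply, Finset.sum_eq_single i]
    · simp [c, hw0 i]
    · intro j _ hj
      simp [Pi.single_eq_of_ne hj]
    · simp
  obtain ⟨l, hl⟩ := exists_pfisterCoeff_equivalent haniso
    (fun L _ _ hL => valuesAreRatios_of_anisotropic.{u, w} hall he L hL) he
  refine ⟨l.length, ((c⁻¹ : Fˣ) : F) • q,
    ⟨l, rfl, hw'.trans (hl.trans (pfisterSpace_equivalent l).symm)⟩, c, ?_⟩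
  rw [smul_smul, ← Units.val_mul, mul_inv_cancel, Units.val_one, one_smul]

end Equivalences

end QuadExt

theorem proposition3 {F : Type u} [Field F] [Invertible (2 : F)]
    {V : Type v} [AddCommGroup V] [Module F V] [FiniteDimensional F V] [Nontrivial V]
    (q : QuadraticForm F V) (hq : q.Anisotropic) :
    List.TFAE [
      QuadExt.IsSimilarToPfister q,
      ∀ (K : Type (max u w)) [Field K] [Algebra F K],
        (1 : Kˣ) ∈ QuadExt.valueSet (q.baseChange K) → QuadExt.IsRound (q.baseChange K),
      ∀ (K : Type (max u w)) [Field K] [Algebra F K],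
        QuadExt.IsIsotropic (q.baseChange K) → QuadExt.IsRound (q.baseChange K)] := by
  tfae_have 1 → 2 := fun h K _ _ => QuadExt.isRound_baseChange_of_isSimilarToPfister h K
  tfae_have 2 → 3 := fun h K _ _ hK => h K (QuadExt.one_mem_valueSet_of_isIsotropic hq K hK)
  tfae_have 3 → 1 := QuadExt.isSimilarToPfister_of_isRound.{u, v, w} hq
  tfae_finish
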